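/- For $n\ge 1$ and a symmetric matrix $(p_{ij})_{i,j=1}^n$ with entries in $[0,1]$, let $A$ be the adjacency matrix of the inhomogeneous Erdős–Rényi random graph $G(n,(p_{ij}))$: $A$ is a random symmetric $n\times n$ matrix with entries in $\{0,1\}$, the entries $A_{ij}$, $i\le j$, are independent, and $\mathbb P(A_{ij}=1)=p_{ij}$ (self-loops are allowed; graphs without self-loops correspond to $p_{ii}=0$). Let $\mathbb E A=(\mathbb E A_{ij})$, let $\|\cdot\|$ be the operator norm with respect to the Euclidean norm on $\mathbb R^n$, and let $d=\max_i\sum_j p_{ij}$ be the maximal expected degree. Then there is an absolute constant $C>0$ such that, for all $n$, $(p_{ij})$ and $A$ as above, $$\mathbb E\|A-\mathbb E A\|\le C\left(\sqrt d+\sqrt{\log n}\right).$$ In particular, for every $c>0$ there is a constant $C_c>0$ depending only on $c$ such that, for all $n$, $(p_{ij})$ and $A$ as above with $d\ge c\log n$, $$\mathbb E\|A-\mathbb E A\|\le C_c\sqrt d.$$ -/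

import Mathlib

universe u

open MeasureTheory ProbabilityTheory
open scoped Matrix.Norms.L2Operator

/-- `A` is (a version of) the adjacency matrix of an inhomogeneous Erdős–Rényi random graph
`G(n, (p i j))` on the vertex set `Fin n`: a random symmetric 0/1-matrix whose entries on and
above the diagonal are independent, with `ℙ(A i j = 1) = p i j`. Self-loops are allowed; a graph
without self-loops is the case `p i i = 0`. The condition `prob` forces `p` to be symmetric with
entries in `[0, 1]`. -/
structure IsInhomogeneousRandomGraph {n : ℕ} {Ω : Type*} [MeasurableSpace Ω] (μ : Measure Ω)
    (p : Matrix (Fin n) (Fin n) ℝ) (A : Ω → Matrix (Fin n) (Fin n) ℝ) : Prop where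
  measurable : ∀ i j, Measurable fun ω => A ω i j
  symm : ∀ ω, (A ω).IsSymm
  zero_or_one : ∀ ω i j, A ω i j = 0 ∨ A ω i j = 1
  prob : ∀ i j, μ.real {ω | A ω i j = 1} = p i j
  indep : iIndepFun (fun (e : {e : Fin n × Fin n // e.1 ≤ e.2}) (ω : Ω) => A ω e.1.1 e.1.2) μ

/-- The entrywise expectation of a random matrix. -/
noncomputable def expectedMatrix {n : ℕ} {Ω : Type*} [MeasurableSpace Ω] (μ : Measure Ω)
    (A : Ω → Matrix (Fin n) (Fin n) ℝ) : Matrix (Fin n) (Fin n) ℝ :=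
  Matrix.of fun i j => ∫ ω, A ω i j ∂μ

/-- The maximal expected degree `d = max_i ∑_j p i j`. -/
noncomputable def maxExpectedDegree {n : ℕ} (p : Matrix (Fin n) (Fin n) ℝ) : ℝ :=
  ⨆ i, ∑ j, p i j

/-! The proof is the moment method combined with a comparison of dimensions. For the centred
symmetric matrix and a large even power q, the trace moment is a sum over closed walks of length q.
By independence, a walk traversing some edge exactly once contributes zero. Any other walk
contributes at most the product of the `p` over its distinct edges, hence at most the product over
the steps that discover a vertex (`prod_traversed_edges_le_newVertexWeight`).

These weighted walks are not counted directly. Grouped by coincidence pattern, they are dominated by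
unweighted walks in a complete graph on r vertices, up to the factor n / r, once r is at least d + q
(`sum_newVertexWeight_le`): a weighted step to a new vertex has total mass at most d, while in the
complete graph at least d fresh vertices always remain. For q at least d, r = 2q suffices.

The count on 2q vertices is in turn at most a normalized trace moment of a 2q × 2q matrix of centred
three-point variables (`card_noSimpleEdge_le_sum_trace`). As its dimension is comparable to q, a net
argument bounds the q-th moment of its norm by (C√q)^q (`sum_norm_threePointMatrix_pow_le`). The
original trace moment is therefore at most n (C√q)^q, and choosing q of order d + log n makes the
q-th root of n bounded. -/

/-! ### Traces of powers, operator norms and nets. -/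

section LinearAlgebra

/-- Contractions of a matrix power as sums over walks. -/
theorem sum_pow_apply_mul_eq_sum_walk {ι : Type*} [Fintype ι] [DecidableEq ι]
    (M : Matrix ι ι ℝ) (k : ℕ) (H : ι → ι → ℝ) :
    ∑ a, ∑ b, (M ^ k) a b * H a b = ∑ w : Fin (k + 1) → ι,
      (∏ i : Fin k, M (w i.castSucc) (w i.succ)) * H (w 0) (w (Fin.last k)) := by
  induction k generalizing H with
  | zero =>
    rw [← (Equiv.funUnique (Fin 1) ι).symm.sum_comp]
    simp [Matrix.one_apply]
  | succ k ih =>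
    have hstep : ∑ a, ∑ b, (M ^ (k + 1)) a b * H a b =
        ∑ a, ∑ c, (M ^ k) a c * ∑ b, M c b * H a b := by
      refine Finset.sum_congr rfl fun a _ => ?_
      simp only [pow_succ, Matrix.mul_apply, Finset.sum_mul, Finset.mul_sum]
      rw [Finset.sum_comm]
      exact Finset.sum_congr rfl fun _ _ => Finset.sum_congr rfl fun _ _ => by ring
    rw [hstep, ih fun a c => ∑ b, M c b * H a b,
      ← (Fin.snocEquiv fun _ : Fin (k + 2) => ι).sum_comp, Fintype.sum_prod_type_right]
    refine Finset.sum_congr rfl fun w _ => ?_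
    rw [Finset.mul_sum]
    refine Finset.sum_congr rfl fun x _ => ?_
    have hw : ∀ i : Fin (k + 1),
        Fin.snocEquiv (fun _ : Fin (k + 2) => ι) (x, w) i.castSucc = w i := fun i =>
      Fin.snoc_castSucc (α := fun _ : Fin (k + 2) => ι) x w i
    have hl : Fin.snocEquiv (fun _ : Fin (k + 2) => ι) (x, w) (Fin.last (k + 1)) = x :=
      Fin.snoc_last (α := fun _ : Fin (k + 2) => ι) x w
    have h0 : Fin.snocEquiv (fun _ : Fin (k + 2) => ι) (x, w) 0 = w 0 := hw 0
    rw [Fin.prod_univ_castSucc, hl, h0, hw (Fin.last k), Fin.succ_last, hl]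
    simp only [hw, Fin.succ_castSucc]
    ring

/-- Addition in `Fin (k + 1)` is cyclic, so the factor at the last index is the closing step back to
`w 0`. -/
theorem trace_pow_eq_sum_closedWalk {ι : Type*} [Fintype ι] [DecidableEq ι]
    (M : Matrix ι ι ℝ) (k : ℕ) :
    (M ^ (k + 1)).trace = ∑ w : Fin (k + 1) → ι, ∏ i, M (w i) (w (i + 1)) := by
  have h := sum_pow_apply_mul_eq_sum_walk M k fun a b => M b a
  have ht : (M ^ (k + 1)).trace = ∑ a, ∑ b, (M ^ k) a b * M b a := by
    simp only [pow_succ, Matrix.trace, Matrix.diag, Matrix.mul_apply]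
  rw [ht, h]
  refine Finset.sum_congr rfl fun w _ => ?_
  rw [Fin.prod_univ_castSucc]
  simp

/-- The trace is the squared Frobenius norm; Cauchy–Schwarz in each row gives the bound. -/
theorem sq_norm_le_trace_mul_transpose {m : ℕ} (M : Matrix (Fin m) (Fin m) ℝ) :
    ‖M‖ ^ 2 ≤ (M * M.transpose).trace := by
  have hS : (M * M.transpose).trace = ∑ i, ∑ j, M i j ^ 2 := by
    simp [Matrix.trace, Matrix.mul_apply, sq]
  have hS0 : 0 ≤ ∑ i, ∑ j, M i j ^ 2 := by positivity
  rw [hS]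
  have : ‖M‖ ≤ √(∑ i, ∑ j, M i j ^ 2) := by
    rw [Matrix.cstar_norm_def]
    refine ContinuousLinearMap.opNorm_le_bound _ (Real.sqrt_nonneg _) fun x => ?_
    rw [EuclideanSpace.norm_eq, EuclideanSpace.norm_eq, ← Real.sqrt_mul hS0]
    refine Real.sqrt_le_sqrt ?_
    rw [Finset.sum_mul]
    refine Finset.sum_le_sum fun i _ => ?_
    simp only [Real.norm_eq_abs, sq_abs]
    rw [Matrix.ofLp_toEuclideanCLM]
    exact Finset.sum_mul_sq_le_sq_mul_sq Finset.univ (M i) x.ofLp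
  calc ‖M‖ ^ 2 ≤ √(∑ i, ∑ j, M i j ^ 2) ^ 2 := by gcongr
    _ = _ := Real.sq_sqrt hS0

/-- Powers of two allow the C*-identity to be iterated, which avoids the spectral theorem: the norm
of `M ^ 2 ^ l` is the corresponding power of the norm, and the Frobenius bound doubles the exponent.
-/
theorem norm_pow_le_trace_pow {m : ℕ} {M : Matrix (Fin m) (Fin m) ℝ} (hM : M.IsSymm) (l : ℕ) :
    ‖M‖ ^ 2 ^ (l + 1) ≤ (M ^ 2 ^ (l + 1)).trace := by
  have hsa : IsSelfAdjoint M := by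
    rw [IsSelfAdjoint, Matrix.star_eq_conjTranspose, Matrix.conjTranspose_eq_transpose_of_trivial]
    exact hM
  have h := sq_norm_le_trace_mul_transpose (M ^ 2 ^ l)
  rw [hsa.norm_pow_two_pow, Matrix.transpose_pow, hM.eq, ← pow_add, ← pow_mul] at h
  convert h using 3 <;> ring

theorem trace_le_card_mul_norm {m : ℕ} (M : Matrix (Fin m) (Fin m) ℝ) :
    M.trace ≤ m * ‖M‖ := by
  have hi : ∀ i, M i i ≤ ‖M‖ := fun i => by
    have h1 := Matrix.inner_toEuclideanCLM M (EuclideanSpace.single i 1) (EuclideanSpace.single i 1)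
    have h2 := real_inner_le_norm (EuclideanSpace.single i (1 : ℝ))
      (Matrix.toEuclideanCLM (n := Fin m) (𝕜 := ℝ) M (EuclideanSpace.single i 1))
    have h3 := (Matrix.toEuclideanCLM (n := Fin m) (𝕜 := ℝ) M).le_opNorm
      (EuclideanSpace.single i 1)
    rw [← Matrix.cstar_norm_def] at h3
    simp at h1 h2 h3
    linarith
  calc M.trace = ∑ i, M i i := rfl
    _ ≤ ∑ _i : Fin m, ‖M‖ := Finset.sum_le_sum fun i _ => hi i
    _ = m * ‖M‖ := by simp

/-- The unit ball of a finite-dimensional normed space has a `1/2`-net of size `5 ^ dim`. -/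
theorem exists_half_net_unitBall (E : Type*) [NormedAddCommGroup E] [NormedSpace ℝ E]
    [FiniteDimensional ℝ E] :
    ∃ N : Finset E, N.card ≤ 5 ^ Module.finrank ℝ E ∧ (∀ x ∈ N, ‖x‖ ≤ 1) ∧
      ∀ x : E, ‖x‖ ≤ 1 → ∃ y ∈ N, ‖x - y‖ ≤ 1 / 2 := by
  classical
  let Q : Finset E → Prop := fun N => (∀ x ∈ N, ‖x‖ ≤ 1) ∧ ∀ x ∈ N, ∀ y ∈ N, x ≠ y → 1 / 2 ≤ ‖x - y‖
  have hcard : ∀ N, Q N → N.card ≤ 5 ^ Module.finrank ℝ E := by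
    rintro N ⟨h1, h2⟩
    -- Doubling turns 1/2-separated points of the unit ball into 1-separated points of the ball of
    -- radius 2, the normalization of the Besicovitch bound.
    have hinj : Function.Injective fun x : E => (2 : ℝ) • x := smul_right_injective E two_ne_zero
    rw [← Finset.card_image_of_injective N hinj]
    refine Besicovitch.card_le_of_separated _ ?_ ?_
    · intro c hc
      obtain ⟨x, hx, rfl⟩ := Finset.mem_image.1 hc
      rw [norm_smul, Real.norm_two]
      linarith [h1 x hx]
    · intro c hc d hd hcd
      obtain ⟨x, hx, rfl⟩ := Finset.mem_image.1 hc
      obtain ⟨y, hy, rfl⟩ := Finset.mem_image.1 hd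
      have := h2 x hx y hy (fun h => hcd (by rw [h]))
      change 1 ≤ ‖(2 : ℝ) • x - (2 : ℝ) • y‖
      rw [← smul_sub, norm_smul, Real.norm_two]
      linarith
  let B : ℕ → Prop := fun c => ∃ N, Q N ∧ N.card = c
  have hB0 : B 0 := ⟨∅, by simp [Q], rfl⟩
  -- A separated set of largest cardinality is a net: a point far from all of it could be added.
  obtain ⟨N, hN, hNc⟩ := Nat.findGreatest_spec (P := B) (Nat.zero_le (5 ^ Module.finrank ℝ E)) hB0
  refine ⟨N, hcard N hN, hN.1, fun x hx => ?_⟩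
  by_contra! hfar
  have hxN : x ∉ N := fun h => by have := hfar x h; norm_num at this
  have hQ : Q (insert x N) := by
    refine ⟨fun y hy => ?_, fun y hy z hz hyz => ?_⟩
    · rcases Finset.mem_insert.1 hy with rfl | hy
      exacts [hx, hN.1 y hy]
    · rcases Finset.mem_insert.1 hy with rfl | hy' <;> rcases Finset.mem_insert.1 hz with rfl | hz'
      · exact absurd rfl hyz
      · exact (hfar z hz').le
      · rw [norm_sub_rev]; exact (hfar y hy').le
      · exact hN.2 y hy' z hz' hyz
  have := Nat.le_findGreatest (P := B) (hcard _ hQ) ⟨_, hQ, rfl⟩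
  rw [Finset.card_insert_of_notMem hxN, hNc] at this
  omega

/-- The operator norm is controlled by the bilinear form on a finite net. -/
theorem exists_net_norm_le (m : ℕ) :
    ∃ N : Finset (EuclideanSpace ℝ (Fin m)), N.card ≤ 5 ^ m ∧ (∀ x ∈ N, ‖x‖ ≤ 1) ∧
      ∀ M : Matrix (Fin m) (Fin m) ℝ, ∃ x ∈ N, ∃ y ∈ N,
        ‖M‖ ≤ 4 * |∑ i, ∑ j, x i * y j * M i j| := by
  obtain ⟨N, hc, h1, hnet⟩ := exists_half_net_unitBall (EuclideanSpace ℝ (Fin m))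
  rw [finrank_euclideanSpace_fin] at hc
  refine ⟨N, hc, h1, fun M => ?_⟩
  set L := Matrix.toEuclideanCLM (n := Fin m) (𝕜 := ℝ) M with hL
  have hLM : ‖M‖ = ‖L‖ := Matrix.cstar_norm_def M
  have hne : N.Nonempty := by
    obtain ⟨y, hy, _⟩ := hnet 0 (by simp)
    exact ⟨y, hy⟩
  obtain ⟨y, hy, hmax⟩ := N.exists_max_image (fun y => ‖L y‖) hne
  have hnorm : ‖L‖ ≤ 2 * ‖L y‖ := by
    have : ‖L‖ ≤ ‖L y‖ + ‖L‖ * (1 / 2) := by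
      refine L.opNorm_le_of_unit_norm (by positivity) fun z hz => ?_
      obtain ⟨w, hw, hzw⟩ := hnet z hz.le
      calc ‖L z‖ = ‖L w + L (z - w)‖ := by rw [← map_add]; congr 2; abel
        _ ≤ ‖L w‖ + ‖L (z - w)‖ := norm_add_le _ _
        _ ≤ ‖L y‖ + ‖L‖ * (1 / 2) := by
          gcongr
          · exact hmax w hw
          · exact (L.le_opNorm _).trans (by gcongr)
    linarith
  -- The vector `x` approximates the direction of `L y`, which costs a second factor 2. If `L y =
  -- 0`, the inverse is 0 and the target is the origin.
  obtain ⟨x, hx, hxv⟩ := hnet (‖L y‖⁻¹ • L y) (by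
    rw [norm_smul, norm_inv, norm_norm]; exact inv_mul_le_one)
  refine ⟨x, hx, y, hy, ?_⟩
  have hform : ∑ i, ∑ j, x i * y j * M i j = inner ℝ x (L y) := by
    rw [hL, Matrix.inner_toEuclideanCLM]
    simp [dotProduct, Matrix.mulVec, Finset.mul_sum]
    refine Finset.sum_congr rfl fun i _ => Finset.sum_congr rfl fun j _ => by ring
  have hself : inner ℝ (‖L y‖⁻¹ • L y) (L y) = ‖L y‖ := by
    rw [real_inner_smul_left, real_inner_self_eq_norm_sq]
    by_cases h : ‖L y‖ = 0
    · simp [h]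
    · field_simp
  have hdiff : inner ℝ (‖L y‖⁻¹ • L y - x) (L y) ≤ 1 / 2 * ‖L y‖ :=
    (real_inner_le_norm _ _).trans (by gcongr)
  rw [inner_sub_left, hself] at hdiff
  rw [hform, hLM]
  linarith [le_abs_self (inner ℝ x (L y))]

end LinearAlgebra
-- Comparison of walk counts with equal coincidence patterns.
section ShapeComparison

/-- The product of `p` over the steps of a walk which reach a vertex for the first time. -/
noncomputable def newVertexWeight {α : Type*} (p : α → α → ℝ) {k : ℕ} (w : Fin (k + 1) → α) : ℝ :=
  open Classical in
  ∏ i : Fin k, if ∃ j < i.succ, w j = w i.succ then 1 else p (w i.castSucc) (w i.succ)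

/-- The coincidence relation of a walk extended by a new vertex. -/
def extendNew {k : ℕ} (R : Fin k → Fin k → Prop) : Fin (k + 1) → Fin (k + 1) → Prop :=
  Fin.lastCases (Fin.lastCases True fun _ => False) fun i => Fin.lastCases False fun j => R i j

/-- The coincidence relation of a walk extended by its `l`-th vertex. -/
def extendOld {k : ℕ} (R : Fin k → Fin k → Prop) (l : Fin k) : Fin (k + 1) → Fin (k + 1) → Prop :=
  Fin.lastCases (Fin.lastCases True fun j => R l j) fun i => Fin.lastCases (R i l) fun j => R i j

/-- The coincidence relation of a walk. -/
def coincidence {α : Type*} {k : ℕ} (w : Fin k → α) : Fin k → Fin k → Prop := fun i j => w i = w j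

variable {α : Type*} {k : ℕ}

theorem coincidence_snoc_new (w : Fin k → α) (x : α) (hx : ¬ ∃ j, w j = x) :
    coincidence (Fin.snoc w x : Fin (k + 1) → α) = extendNew (coincidence w) := by
  have hx' : ∀ j, ¬ x = w j := fun j h => hx ⟨j, h.symm⟩
  push Not at hx
  ext a b
  refine Fin.lastCases ?_ (fun i => ?_) a <;> refine Fin.lastCases ?_ (fun j => ?_) b <;>
    simp [coincidence, extendNew, hx, hx']

theorem coincidence_snoc_old (w : Fin k → α) (l : Fin k) :
    coincidence (Fin.snoc w (w l) : Fin (k + 1) → α) = extendOld (coincidence w) l := by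
  ext a b
  refine Fin.lastCases ?_ (fun i => ?_) a <;> refine Fin.lastCases ?_ (fun j => ?_) b <;>
    simp [coincidence, extendOld]

theorem newVertexWeight_snoc (p : α → α → ℝ) (w : Fin (k + 1) → α) (x : α)
    [Decidable (∃ j, w j = x)] :
    newVertexWeight p (Fin.snoc w x : Fin (k + 2) → α) =
      newVertexWeight p w *
        if ∃ j, w j = x then 1 else p (w (Fin.last k)) x := by
  classical
  rw [newVertexWeight, Fin.prod_univ_castSucc, newVertexWeight]
  have hex : ∀ (i : Fin (k + 1)) (y : α),
      (∃ j < i.succ, (Fin.snoc w x : Fin (k + 2) → α) j = y) ↔ ∃ j ≤ i, w j = y := by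
    intro i y
    constructor
    · rintro ⟨j, hj, h⟩
      induction j using Fin.lastCases with
      | last => exact absurd hj (not_lt.2 (Fin.le_last _))
      | cast j =>
        rw [Fin.snoc_castSucc] at h
        exact ⟨j, Fin.castSucc_lt_succ_iff.1 hj, h⟩
    · rintro ⟨j, hj, h⟩
      exact ⟨j.castSucc, Fin.castSucc_lt_succ_iff.2 hj, by rwa [Fin.snoc_castSucc]⟩
  have hex' : ∀ (i : Fin k) (y : α), (∃ j < i.succ, w j = y) ↔ ∃ j ≤ i.castSucc, w j = y := by
    intro i y
    refine exists_congr fun j => and_congr_left fun _ => ?_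
    rw [Fin.lt_def, Fin.le_def]; simp
  simp only [hex, hex']
  congr 1
  · refine Finset.prod_congr rfl fun i _ => ?_
    rw [Fin.snoc_castSucc, Fin.succ_castSucc, Fin.snoc_castSucc]
  · rw [Fin.snoc_castSucc, Fin.succ_last, Fin.snoc_last]
    simp [Fin.le_last]

theorem newVertexWeight_nonneg {p : α → α → ℝ} (hp : ∀ a b, 0 ≤ p a b) (w : Fin (k + 1) → α) :
    0 ≤ newVertexWeight p w := by
  classical
  refine Finset.prod_nonneg fun i _ => ?_
  split_ifs
  exacts [zero_le_one, hp _ _]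

open Classical in
/-- A sum over the values of `w` as a sum over the places where they first occur. -/
theorem sum_range_eq_sum_first {m : ℕ} (w : Fin k → Fin m) (g : Fin m → ℝ) :
    ∑ x with ∃ j, w j = x, g x = ∑ j with ∀ i < j, ¬ coincidence w i j, g (w j) := by
  symm
  refine Finset.sum_nbij w ?_ ?_ ?_ fun _ _ => rfl
  · intro j _; simp
  · intro i hi j hj hij
    have hi := (Finset.mem_filter.1 (Finset.mem_coe.1 hi)).2
    have hj := (Finset.mem_filter.1 (Finset.mem_coe.1 hj)).2
    rcases lt_trichotomy i j with h | h | h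
    exacts [absurd hij (hj i h), h, absurd hij.symm (hi j h)]
  · intro x hx
    have hx' : ∃ j, w j = x := by simpa using hx
    obtain ⟨j, hj, hmin⟩ := WellFounded.has_min (wellFounded_lt (α := Fin k)) {j | w j = x} hx'
    refine ⟨j, Finset.mem_coe.2 (Finset.mem_filter.2 ⟨Finset.mem_univ _, fun i hi h => ?_⟩), hj⟩
    exact hmin i (Eq.trans h hj) hi

open Classical in
/-- A weighted count of walks with a given coincidence pattern is dominated by the unweighted count
in a complete graph with sufficiently many vertices. -/
theorem sum_newVertexWeight_le {n r k : ℕ} {p : Fin n → Fin n → ℝ} (hp : ∀ a b, 0 ≤ p a b) {D : ℝ}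
    (hD : ∀ a, ∑ b, p a b ≤ D) (hr : D + k ≤ r) (F : (Fin (k + 1) → Fin (k + 1) → Prop) → ℝ)
    (hF : ∀ R, 0 ≤ F R) :
    r * ∑ w : Fin (k + 1) → Fin n, newVertexWeight p w * F (coincidence w) ≤
      n * ∑ v : Fin (k + 1) → Fin r, F (coincidence v) := by
  induction k with
  | zero =>
    have h : ∀ {m : ℕ} (w : Fin 1 → Fin m), coincidence w = fun _ _ => True := fun w => by
      ext i j; simp [coincidence, Subsingleton.elim i j]
    simp only [h, newVertexWeight, Finset.univ_eq_empty, Finset.prod_empty, one_mul]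
    simp
    exact le_of_eq (by ring)
  | succ k ih =>
    -- `G` integrates out the last vertex: mass `D` for a new vertex, mass 1 for each vertex already
    -- visited. It bounds the weighted sum from above and the unweighted sum on `r` vertices from
    -- below, so the induction hypothesis applied to `G` closes the step.
    let G : (Fin (k + 1) → Fin (k + 1) → Prop) → ℝ := fun R =>
      D * F (extendNew R) + ∑ j with ∀ i < j, ¬ R i j, F (extendOld R j)
    rcases Nat.eq_zero_or_pos n with rfl | hn
    · simp
    have hD0 : 0 ≤ D := (Finset.sum_nonneg fun b _ => hp ⟨0, hn⟩ b).trans (hD ⟨0, hn⟩)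
    have hG : ∀ R, 0 ≤ G R := fun R =>
      add_nonneg (mul_nonneg hD0 (hF _)) (Finset.sum_nonneg fun _ _ => hF _)
    push_cast at hr
    have hsplit : ∀ {m : ℕ} (w : Fin (k + 1) → Fin m) (c : Fin m → ℝ),
        ∑ x, (if ∃ j, w j = x then 1 else c x) *
          F (coincidence (Fin.snoc w x : Fin (k + 2) → Fin m)) =
        (∑ x with ¬ ∃ j, w j = x, c x) * F (extendNew (coincidence w)) +
          ∑ j with ∀ i < j, ¬ coincidence w i j, F (extendOld (coincidence w) j) := by
      intro m w c
      rw [← Finset.sum_filter_add_sum_filter_not _ (fun x => ∃ j, w j = x), add_comm]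
      congr 1
      · rw [Finset.sum_mul]
        refine Finset.sum_congr rfl fun x hx => ?_
        have hx' := (Finset.mem_filter.1 hx).2
        rw [if_neg hx', coincidence_snoc_new w x hx']
      · rw [Finset.sum_congr rfl (g := fun x => F (coincidence
          (Fin.snoc w x : Fin (k + 2) → Fin m))) fun x hx => by
            rw [if_pos (Finset.mem_filter.1 hx).2, one_mul], sum_range_eq_sum_first]
        exact Finset.sum_congr rfl fun j _ => by rw [coincidence_snoc_old]
    have hsnoc : ∀ {m : ℕ} (Φ : (Fin (k + 2) → Fin m) → ℝ),
        ∑ w, Φ w = ∑ w : Fin (k + 1) → Fin m, ∑ x, Φ (Fin.snoc w x) := by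
      intro m Φ
      rw [← (Fin.snocEquiv fun _ : Fin (k + 2) => Fin m).sum_comp, Fintype.sum_prod_type_right]
      rfl
    have hup : ∀ w : Fin (k + 1) → Fin n,
        ∑ x, newVertexWeight p (Fin.snoc w x : Fin (k + 2) → Fin n) *
          F (coincidence (Fin.snoc w x : Fin (k + 2) → Fin n)) ≤
        newVertexWeight p w * G (coincidence w) := by
      intro w
      simp only [newVertexWeight_snoc, mul_assoc]
      rw [← Finset.mul_sum, hsplit w (p (w (Fin.last k)))]
      refine mul_le_mul_of_nonneg_left ?_ (newVertexWeight_nonneg hp w)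
      refine add_le_add (mul_le_mul_of_nonneg_right ?_ (hF _)) le_rfl
      refine le_trans ?_ (hD (w (Fin.last k)))
      exact Finset.sum_le_sum_of_subset_of_nonneg (Finset.filter_subset _ _) fun _ _ _ => hp _ _
    have hlow : ∀ v : Fin (k + 1) → Fin r, G (coincidence v) ≤
        ∑ x, F (coincidence (Fin.snoc v x : Fin (k + 2) → Fin r)) := by
      intro v
      have h1 := hsplit v fun _ => 1
      simp only [ite_self, one_mul] at h1
      rw [h1]
      refine add_le_add (mul_le_mul_of_nonneg_right ?_ (hF _)) le_rfl
      have hc : (Finset.univ.filter fun x => ∃ j, v j = x).card ≤ k + 1 := by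
        have : (Finset.univ.filter fun x => ∃ j, v j = x) = Finset.univ.image v := by
          ext x; simp
        rw [this]
        exact Finset.card_image_le.trans (by simp)
      have hs := Finset.card_filter_add_card_filter_not (s := (Finset.univ : Finset (Fin r)))
        (fun x => ∃ j, v j = x)
      rw [Finset.card_univ, Fintype.card_fin] at hs
      rw [Finset.sum_const, nsmul_eq_mul, mul_one]
      have hs' : (r : ℝ) = ((Finset.univ.filter fun x => ∃ j, v j = x).card : ℝ) +
        ((Finset.univ.filter fun x => ¬ ∃ j, v j = x).card : ℝ) := by exact_mod_cast hs.symm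
      have hc' : ((Finset.univ.filter fun x => ∃ j, v j = x).card : ℝ) ≤ k + 1 := by
        exact_mod_cast hc
      linarith
    rw [hsnoc, hsnoc]
    calc _ ≤ (r : ℝ) * ∑ w : Fin (k + 1) → Fin n, newVertexWeight p w * G (coincidence w) := by
          gcongr with w _
          exact hup w
      _ ≤ n * ∑ v : Fin (k + 1) → Fin r, G (coincidence v) := ih (by linarith) G hG
      _ ≤ _ := by
          gcongr with v _
          exact hlow v

end ShapeComparison
-- Edge multiplicities of closed walks.
section EdgeCount

/-- The number of times a closed walk traverses an edge. -/
def edgeCount {n k : ℕ} (w : Fin (k + 1) → Fin n) (e : Sym2 (Fin n)) : ℕ :=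
  (Finset.univ.filter fun i => s(w i, w (i + 1)) = e).card

theorem prod_edges_eq_prod_pow_edgeCount {n k : ℕ} (w : Fin (k + 1) → Fin n)
    (f : Sym2 (Fin n) → ℝ) : ∏ i, f s(w i, w (i + 1)) = ∏ e, f e ^ edgeCount w e := by
  rw [← Finset.prod_fiberwise Finset.univ (fun i => s(w i, w (i + 1)))]
  refine Finset.prod_congr rfl fun e _ => ?_
  rw [Finset.prod_congr rfl (g := fun _ => f e) fun i hi => by rw [(Finset.mem_filter.1 hi).2],
    Finset.prod_const, edgeCount]

/-- A coincidence relation under which no edge of the closed walk is traversed exactly once. -/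
def NoSimpleEdge {k : ℕ} (R : Fin (k + 1) → Fin (k + 1) → Prop) : Prop :=
  ∀ i, ∃ j, j ≠ i ∧ ((R i j ∧ R (i + 1) (j + 1)) ∨ (R i (j + 1) ∧ R (i + 1) j))

/-- Vanishing by centring thus depends only on the coincidence pattern, so its indicator can serve
as the function `F` in `sum_newVertexWeight_le`. -/
theorem noSimpleEdge_coincidence_iff {n k : ℕ} (w : Fin (k + 1) → Fin n) :
    NoSimpleEdge (coincidence w) ↔ ∀ e, edgeCount w e ≠ 1 := by
  have hR : NoSimpleEdge (coincidence w) ↔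
      ∀ i, ∃ j, j ≠ i ∧ s(w i, w (i + 1)) = s(w j, w (j + 1)) := by
    simp only [NoSimpleEdge, coincidence, Sym2.eq_iff]
  rw [hR]
  constructor
  · intro h e he
    obtain ⟨i, hi⟩ := Finset.card_eq_one.1 he
    have hie : s(w i, w (i + 1)) = e := by
      have : i ∈ Finset.univ.filter fun i => s(w i, w (i + 1)) = e := by rw [hi]; simp
      exact (Finset.mem_filter.1 this).2
    obtain ⟨j, hji, hj⟩ := h i
    have : j ∈ Finset.univ.filter fun i => s(w i, w (i + 1)) = e := by
      rw [Finset.mem_filter]; exact ⟨Finset.mem_univ _, hj.symm.trans hie⟩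
    rw [hi, Finset.mem_singleton] at this
    exact hji this
  · intro h i
    by_contra! hcon
    refine h s(w i, w (i + 1)) (Finset.card_eq_one.2 ⟨i, ?_⟩)
    ext j
    simp only [Finset.mem_filter, Finset.mem_univ, true_and, Finset.mem_singleton]
    refine ⟨fun hj => by_contra fun hji => hcon j hji hj.symm, fun hj => by rw [hj]⟩

end EdgeCount

/-! ### The three-point comparison matrix and its moments. -/

section ThreePoint

/-- A centred three-point law (under the uniform weight) whose moments of order at least two are
at least one. -/
def threePoint : Fin 3 → ℝ := ![2, -1, -1]

/-- The symmetric matrix with entries `threePoint`. -/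
def threePointMatrix {r : ℕ} (ω : Sym2 (Fin r) → Fin 3) : Matrix (Fin r) (Fin r) ℝ :=
  Matrix.of fun i j => threePoint (ω s(i, j))

theorem sum_threePoint (f : ℝ → ℝ) : ∑ a, f (threePoint a) = f 2 + 2 * f (-1) := by
  simp [Fin.sum_univ_three, threePoint]; ring

/-- This is why the law is skewed: symmetric signs would have vanishing odd moments and lose the
walks that traverse an edge three times. -/
theorem three_le_sum_threePoint_pow {c : ℕ} (hc : c ≠ 1) : 3 ≤ ∑ a, threePoint a ^ c := by
  rw [sum_threePoint (fun x => x ^ c)]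
  match c, hc with
  | 0, _ => norm_num
  | 2, _ => norm_num
  | c + 3, _ =>
    have h1 : (1 : ℝ) ≤ 2 ^ c := one_le_pow₀ (by norm_num)
    have h2 : (-1 : ℝ) ≤ (-1) ^ (c + 3) := by
      rcases neg_one_pow_eq_or ℝ (c + 3) with h | h <;> rw [h]; norm_num
    rw [pow_add]
    linarith

theorem sum_threePoint_pow_nonneg (c : ℕ) : 0 ≤ ∑ a, threePoint a ^ c := by
  by_cases hc : c = 1
  · subst hc; rw [sum_threePoint (fun x => x ^ 1)]; norm_num
  · exact le_trans (by norm_num) (three_le_sum_threePoint_pow hc)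

/-- Symmetrization: by centring the same sum at `-t` is at least 3, and the product of the two sums
is 5 + 4 cosh 3t ≤ 9 cosh 3t. -/
theorem sum_threePoint_exp_le (t : ℝ) :
    ∑ a, Real.exp (t * threePoint a) ≤ 3 * Real.exp (9 / 2 * t ^ 2) := by
  rw [sum_threePoint (fun x => Real.exp (t * x))]
  have hpos : 0 ≤ Real.exp (t * 2) + 2 * Real.exp (t * -1) := by positivity
  have hneg : 3 ≤ Real.exp (-(t * 2)) + 2 * Real.exp t := by
    linarith [Real.add_one_le_exp (-(t * 2)), Real.add_one_le_exp t]
  have hcosh := Real.cosh_le_exp_half_sq (3 * t)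
  have hone := Real.one_le_cosh (3 * t)
  have hexp : (3 * t) ^ 2 / 2 = 9 / 2 * t ^ 2 := by ring
  rw [hexp] at hcosh
  have hprod : (Real.exp (t * 2) + 2 * Real.exp (t * -1)) *
      (Real.exp (-(t * 2)) + 2 * Real.exp t) = 5 + 4 * Real.cosh (3 * t) := by
    rw [Real.cosh_eq]
    have e1 : Real.exp (t * 2) * Real.exp (-(t * 2)) = 1 := by rw [← Real.exp_add]; simp
    have e2 : Real.exp (t * -1) * Real.exp t = 1 := by rw [← Real.exp_add]; simp
    have e3 : Real.exp (t * 2) * Real.exp t = Real.exp (3 * t) := by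
      rw [← Real.exp_add]; ring_nf
    have e4 : Real.exp (t * -1) * Real.exp (-(t * 2)) = Real.exp (-(3 * t)) := by
      rw [← Real.exp_add]; ring_nf
    linear_combination e1 + 4 * e2 + 2 * e3 + 2 * e4
  nlinarith [mul_le_mul_of_nonneg_left hneg hpos]

theorem sum_prod_eq_prod_sum_three {E : Type*} [Fintype E] [DecidableEq E] (g : E → Fin 3 → ℝ) :
    ∑ ω : E → Fin 3, ∏ e, g e (ω e) = ∏ e, ∑ a, g e a := by
  rw [Finset.prod_univ_sum, Fintype.piFinset_univ]

open Classical in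
/-- The trace moments of `threePointMatrix` count closed walks without simple edges. -/
theorem card_noSimpleEdge_le_sum_trace (r k : ℕ) :
    3 ^ Fintype.card (Sym2 (Fin r)) *
      ∑ v : Fin (k + 1) → Fin r, (if NoSimpleEdge (coincidence v) then (1 : ℝ) else 0) ≤
    ∑ ω : Sym2 (Fin r) → Fin 3, (threePointMatrix ω ^ (k + 1)).trace := by
  simp only [trace_pow_eq_sum_closedWalk]
  rw [Finset.sum_comm, Finset.mul_sum]
  refine Finset.sum_le_sum fun v _ => ?_
  have hprod : ∑ ω : Sym2 (Fin r) → Fin 3, ∏ i, threePointMatrix ω (v i) (v (i + 1)) =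
      ∏ e, ∑ a, threePoint a ^ edgeCount v e := by
    rw [← sum_prod_eq_prod_sum_three]
    exact Finset.sum_congr rfl fun ω _ =>
      prod_edges_eq_prod_pow_edgeCount v fun e => threePoint (ω e)
  rw [hprod]
  split_ifs with h
  · rw [mul_one, Fintype.card, ← Finset.prod_const]
    exact Finset.prod_le_prod (fun _ _ => by norm_num) fun e _ =>
      three_le_sum_threePoint_pow ((noSimpleEdge_coincidence_iff v).1 h e)
  · rw [mul_zero]
    exact Finset.prod_nonneg fun e _ => sum_threePoint_pow_nonneg _

theorem sum_exp_linear_threePoint_le {E : Type*} [Fintype E] [DecidableEq E] (c : E → ℝ) :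
    ∑ ω : E → Fin 3, Real.exp (∑ e, c e * threePoint (ω e)) ≤
      3 ^ Fintype.card E * Real.exp (9 / 2 * ∑ e, c e ^ 2) := by
  simp only [Real.exp_sum]
  rw [sum_prod_eq_prod_sum_three fun e a => Real.exp (c e * threePoint a)]
  calc _ ≤ ∏ e, (3 * Real.exp (9 / 2 * c e ^ 2)) :=
        Finset.prod_le_prod (fun _ _ => by positivity) fun e _ => sum_threePoint_exp_le (c e)
    _ = _ := by
        rw [Finset.prod_mul_distrib, Finset.prod_const, Finset.card_univ, ← Real.exp_sum,
          Finset.mul_sum]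

theorem pow_le_factorial_mul_exp_add_exp {q : ℕ} (hq : Even q) (z : ℝ) :
    z ^ q ≤ q.factorial * (Real.exp z + Real.exp (-z)) := by
  have h := Real.pow_div_factorial_le_exp |z| (abs_nonneg z) q
  rw [hq.pow_abs, div_le_iff₀ (by positivity), mul_comm] at h
  refine h.trans ?_
  gcongr
  rcases abs_cases z with ⟨h, _⟩ | ⟨h, _⟩ <;> rw [h]
  · linarith [Real.exp_pos (-z)]
  · linarith [Real.exp_pos z]

/-- A Khintchine-type moment bound for linear forms in `threePoint` variables. -/
theorem sum_linear_threePoint_pow_le {E : Type*} [Fintype E] [DecidableEq E] {c : E → ℝ}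
    (hc : ∑ e, c e ^ 2 ≤ 2) {q : ℕ} (hq : Even q) (hq0 : 0 < q) :
    ∑ ω : E → Fin 3, (∑ e, c e * threePoint (ω e)) ^ q ≤
      3 ^ Fintype.card E * (2 * Real.exp 9 * √q) ^ q := by
  have hsq : 0 < √(q : ℝ) := Real.sqrt_pos.2 (by exact_mod_cast hq0)
  have hsq2 : √(q : ℝ) ^ 2 = q := Real.sq_sqrt (by positivity)
  have hexp : ∀ s : ℝ, s ^ 2 = q → ∑ ω : E → Fin 3, Real.exp (s * ∑ e, c e * threePoint (ω e)) ≤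
      3 ^ Fintype.card E * Real.exp (9 * q) := by
    intro s hs
    have h := sum_exp_linear_threePoint_le fun e => s * c e
    have hl : ∀ ω : E → Fin 3, ∑ e, s * c e * threePoint (ω e) =
        s * ∑ e, c e * threePoint (ω e) := fun ω => by
      rw [Finset.mul_sum]; exact Finset.sum_congr rfl fun _ _ => by ring
    simp only [hl, mul_pow, ← Finset.mul_sum, hs] at h
    refine h.trans ?_
    refine mul_le_mul_of_nonneg_left (Real.exp_le_exp.2 ?_) (by positivity)
    nlinarith [(Nat.cast_nonneg q : (0 : ℝ) ≤ q)]
  -- The exponential moment is taken at ±√q, where it is exponential in `q`. As q! ≤ (√q)^(2q), one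
  -- factor (√q)^q survives the division.
  have hmain : √(q : ℝ) ^ q * ∑ ω : E → Fin 3, (∑ e, c e * threePoint (ω e)) ^ q ≤
      q.factorial * (2 * (3 ^ Fintype.card E * Real.exp (9 * q))) := by
    rw [Finset.mul_sum]
    calc _ ≤ ∑ ω : E → Fin 3, (q.factorial : ℝ) *
          (Real.exp (√q * ∑ e, c e * threePoint (ω e)) +
            Real.exp (-√q * ∑ e, c e * threePoint (ω e))) := by
          refine Finset.sum_le_sum fun ω _ => ?_
          rw [← mul_pow, neg_mul]
          exact pow_le_factorial_mul_exp_add_exp hq _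
      _ ≤ _ := by
          rw [← Finset.mul_sum, Finset.sum_add_distrib]
          gcongr
          linarith [hexp (√q) hsq2, hexp (-√q) (by rw [neg_sq, hsq2])]
  have hfac : (q.factorial : ℝ) ≤ √(q : ℝ) ^ q * √(q : ℝ) ^ q := by
    rw [← mul_pow, ← sq, hsq2]; exact_mod_cast Nat.factorial_le_pow q
  have h2 : (2 : ℝ) ≤ 2 ^ q := le_self_pow₀ (by norm_num) hq0.ne'
  have he : Real.exp (9 * q) = Real.exp 9 ^ q := by rw [← Real.exp_nat_mul]; ring_nf
  rw [he] at hmain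
  refine le_of_mul_le_mul_left (hmain.trans ?_) (pow_pos hsq q)
  calc _ ≤ √(q : ℝ) ^ q * √(q : ℝ) ^ q *
        (2 ^ q * (3 ^ Fintype.card E * Real.exp 9 ^ q)) := by gcongr
    _ = _ := by rw [mul_pow, mul_pow]; ring

theorem sum_sq_le_of_euclidean_norm_le_one {m : ℕ} {x : EuclideanSpace ℝ (Fin m)} (hx : ‖x‖ ≤ 1) :
    ∑ i, x i ^ 2 ≤ 1 := by
  have := EuclideanSpace.real_norm_sq_eq x
  rw [← this]
  exact pow_le_one₀ (norm_nonneg _) hx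

theorem sum_bilinear_threePoint_pow_le {r : ℕ} {x y : EuclideanSpace ℝ (Fin r)} (hx : ‖x‖ ≤ 1)
    (hy : ‖y‖ ≤ 1) {q : ℕ} (hq : Even q) (hq0 : 0 < q) :
    ∑ ω : Sym2 (Fin r) → Fin 3, (∑ i, ∑ j, x i * y j * threePointMatrix ω i j) ^ q ≤
      3 ^ Fintype.card (Sym2 (Fin r)) * (2 * Real.exp 9 * √q) ^ q := by
  let c : Sym2 (Fin r) → ℝ := fun e =>
    ∑ ij : Fin r × Fin r with s(ij.1, ij.2) = e, x ij.1 * y ij.2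
  have hform : ∀ ω : Sym2 (Fin r) → Fin 3, ∑ i, ∑ j, x i * y j * threePointMatrix ω i j =
      ∑ e, c e * threePoint (ω e) := by
    intro ω
    rw [← Fintype.sum_prod_type' (f := fun i j => x i * y j * threePointMatrix ω i j),
      ← Finset.sum_fiberwise Finset.univ (fun ij : Fin r × Fin r => s(ij.1, ij.2))]
    refine Finset.sum_congr rfl fun e _ => ?_
    rw [Finset.sum_mul]
    refine Finset.sum_congr rfl fun ij hij => ?_
    rw [threePointMatrix, Matrix.of_apply, (Finset.mem_filter.1 hij).2]
  -- An unordered pair comes from at most two ordered pairs, hence the 2.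
  have hc : ∑ e, c e ^ 2 ≤ 2 := by
    calc ∑ e, c e ^ 2 ≤ ∑ e, 2 * ∑ ij : Fin r × Fin r with s(ij.1, ij.2) = e,
          (x ij.1 * y ij.2) ^ 2 := by
          refine Finset.sum_le_sum fun e _ => ?_
          refine (sq_sum_le_card_mul_sum_sq).trans ?_
          gcongr
          induction e using Sym2.inductionOn with
          | _ a b =>
            have hsub : (Finset.univ.filter fun ij : Fin r × Fin r => s(ij.1, ij.2) = s(a, b)) ⊆
                {(a, b), (b, a)} := by
              intro ij hij
              have := Sym2.eq_iff.1 (Finset.mem_filter.1 hij).2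
              simpa [Prod.ext_iff] using this
            exact_mod_cast (Finset.card_le_card hsub).trans Finset.card_le_two
      _ = 2 * ((∑ i, x i ^ 2) * ∑ j, y j ^ 2) := by
          rw [← Finset.mul_sum, Finset.sum_fiberwise, Fintype.sum_prod_type, Finset.sum_mul_sum]
          simp only [mul_pow]
      _ ≤ 2 := by
          have h := mul_le_one₀ (sum_sq_le_of_euclidean_norm_le_one hx)
            (Finset.sum_nonneg fun j _ => sq_nonneg (y j)) (sum_sq_le_of_euclidean_norm_le_one hy)
          linarith
  simp only [hform]
  exact sum_linear_threePoint_pow_le hc hq hq0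

/-- High moments of the norm of `threePointMatrix`. -/
theorem sum_norm_threePointMatrix_pow_le {q : ℕ} (hq : Even q) (hq0 : 0 < q) :
    ∑ ω : Sym2 (Fin (2 * q)) → Fin 3, ‖threePointMatrix ω‖ ^ q ≤
      3 ^ Fintype.card (Sym2 (Fin (2 * q))) * (5000 * Real.exp 9 * √q) ^ q := by
  obtain ⟨N, hNc, hN1, hN⟩ := exists_net_norm_le (2 * q)
  have hω : ∀ ω : Sym2 (Fin (2 * q)) → Fin 3, ‖threePointMatrix ω‖ ^ q ≤
      ∑ x ∈ N, ∑ y ∈ N, 4 ^ q * (∑ i, ∑ j, x i * y j * threePointMatrix ω i j) ^ q := by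
    intro ω
    obtain ⟨x, hx, y, hy, h⟩ := hN (threePointMatrix ω)
    have hpos : ∀ x y : EuclideanSpace ℝ (Fin (2 * q)),
        0 ≤ 4 ^ q * (∑ i, ∑ j, x i * y j * threePointMatrix ω i j) ^ q := fun x y =>
      mul_nonneg (by positivity) (hq.pow_nonneg _)
    calc ‖threePointMatrix ω‖ ^ q
        ≤ (4 * |∑ i, ∑ j, x i * y j * threePointMatrix ω i j|) ^ q := by gcongr
      _ = 4 ^ q * (∑ i, ∑ j, x i * y j * threePointMatrix ω i j) ^ q := by
          rw [mul_pow, hq.pow_abs]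
      _ ≤ ∑ y ∈ N, 4 ^ q * (∑ i, ∑ j, x i * y j * threePointMatrix ω i j) ^ q :=
          Finset.single_le_sum (f := fun y : EuclideanSpace ℝ (Fin (2 * q)) =>
            4 ^ q * (∑ i, ∑ j, x i * y j * threePointMatrix ω i j) ^ q) (fun y _ => hpos x y) hy
      _ ≤ _ := Finset.single_le_sum (f := fun x : EuclideanSpace ℝ (Fin (2 * q)) =>
            ∑ y ∈ N, 4 ^ q * (∑ i, ∑ j, x i * y j * threePointMatrix ω i j) ^ q)
            (fun x _ => Finset.sum_nonneg fun y _ => hpos x y) hx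
  -- With dimension 2q, the union bound over pairs of net points costs only a constant after a q-th
  -- root; 25 · 25 · 4 · 2 = 5000.
  have hNc' : (N.card : ℝ) ≤ 25 ^ q := by
    calc (N.card : ℝ) ≤ 5 ^ (2 * q) := by exact_mod_cast hNc
      _ = 25 ^ q := by rw [pow_mul]; norm_num
  calc _ ≤ ∑ ω : Sym2 (Fin (2 * q)) → Fin 3, ∑ x ∈ N, ∑ y ∈ N,
        4 ^ q * (∑ i, ∑ j, x i * y j * threePointMatrix ω i j) ^ q :=
        Finset.sum_le_sum fun ω _ => hω ω
    _ = ∑ x ∈ N, ∑ y ∈ N, 4 ^ q * ∑ ω : Sym2 (Fin (2 * q)) → Fin 3,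
        (∑ i, ∑ j, x i * y j * threePointMatrix ω i j) ^ q := by
        rw [Finset.sum_comm]
        refine Finset.sum_congr rfl fun x _ => ?_
        rw [Finset.sum_comm]
        exact Finset.sum_congr rfl fun y _ => by rw [Finset.mul_sum]
    _ ≤ ∑ x ∈ N, ∑ y ∈ N, 4 ^ q *
        (3 ^ Fintype.card (Sym2 (Fin (2 * q))) * (2 * Real.exp 9 * √q) ^ q) := by
        gcongr with x hx y hy
        exact sum_bilinear_threePoint_pow_le (hN1 x hx) (hN1 y hy) hq hq0
    _ = N.card * (N.card * (4 ^ q *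
        (3 ^ Fintype.card (Sym2 (Fin (2 * q))) * (2 * Real.exp 9 * √q) ^ q))) := by
        simp only [Finset.sum_const, nsmul_eq_mul]
    _ ≤ 25 ^ q * (25 ^ q * (4 ^ q *
        (3 ^ Fintype.card (Sym2 (Fin (2 * q))) * (2 * Real.exp 9 * √q) ^ q))) := by gcongr
    _ = 3 ^ Fintype.card (Sym2 (Fin (2 * q))) * (25 * 25 * 4 * (2 * Real.exp 9 * √q)) ^ q := by
        rw [mul_pow (25 * 25 * 4), mul_pow (25 * 25), mul_pow 25]; ring
    _ = _ := by ring_nf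

end ThreePoint
-- Trace moments of matrices with independent centred entries.
section RandomMatrix

/-- The edge weights along a walk are dominated by those leading to new vertices. -/
theorem prod_traversed_edges_le_newVertexWeight {n k : ℕ} {P : Sym2 (Fin n) → ℝ}
    (hP0 : ∀ e, 0 ≤ P e) (hP1 : ∀ e, P e ≤ 1) (w : Fin (k + 1) → Fin n) :
    ∏ e with edgeCount w e ≠ 0, P e ≤ newVertexWeight (fun a b => P s(a, b)) w := by
  classical
  let I : Finset (Fin k) := Finset.univ.filter fun i => ¬ ∃ j < i.succ, w j = w i.succ
  let ed : Fin k → Sym2 (Fin n) := fun i => s(w i.castSucc, w i.succ)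
  -- Discovery steps use distinct edges: the vertex discovered later is not an endpoint of any
  -- earlier edge.
  have hlt : ∀ i ∈ I, ∀ j ∈ I, i < j → ed i ≠ ed j := by
    intro i _ j hj hij h
    have hj' := (Finset.mem_filter.1 hj).2
    have hmem : w j.succ ∈ ed i := by rw [h]; exact Sym2.mem_mk_right _ _
    rcases Sym2.mem_iff.1 hmem with h' | h'
    · exact hj' ⟨i.castSucc, (Fin.castSucc_lt_succ).trans (Fin.succ_lt_succ_iff.2 hij), h'.symm⟩
    · exact hj' ⟨i.succ, Fin.succ_lt_succ_iff.2 hij, h'.symm⟩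
  have hinj : Set.InjOn ed I := by
    intro i hi j hj h
    rcases lt_trichotomy i j with hij | hij | hij
    exacts [absurd h (hlt i hi j hj hij), hij, absurd h.symm (hlt j hj i hi hij)]
  have hT : newVertexWeight (fun a b => P s(a, b)) w = ∏ e ∈ I.image ed, P e := by
    rw [Finset.prod_image hinj, newVertexWeight, Finset.prod_filter]
    refine Finset.prod_congr rfl fun i _ => ?_
    by_cases h : ∃ j < i.succ, w j = w i.succ
    · rw [if_pos h, if_neg (not_not.2 h)]
    · rw [if_neg h, if_pos h]
  rw [hT]
  refine Finset.prod_le_prod_of_subset_of_le_one ?_ (fun e _ => hP0 e) (fun e _ _ => hP1 e)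
  intro e he
  obtain ⟨i, _, rfl⟩ := Finset.mem_image.1 he
  refine Finset.mem_filter.2 ⟨Finset.mem_univ _, Finset.card_ne_zero_of_mem (a := i.castSucc) ?_⟩
  simp [ed]

/-- Independent centred edge variables bounded by one with second moments at most `P`. -/
structure IsCenteredEdgeFamily {n : ℕ} {Ω : Type*} [MeasurableSpace Ω] (μ : Measure Ω)
    (P : Sym2 (Fin n) → ℝ) (ξ : Sym2 (Fin n) → Ω → ℝ) : Prop where
  measurable : ∀ e, Measurable (ξ e)
  abs_le_one : ∀ e ω, |ξ e ω| ≤ 1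
  indep : iIndepFun ξ μ
  integral_eq_zero : ∀ e, ∫ ω, ξ e ω ∂μ = 0
  integral_sq_le : ∀ e, ∫ ω, ξ e ω ^ 2 ∂μ ≤ P e
  le_one : ∀ e, P e ≤ 1

/-- The symmetric random matrix with given edge variables. -/
def edgeMatrix {n : ℕ} {Ω : Type*} (ξ : Sym2 (Fin n) → Ω → ℝ) (ω : Ω) : Matrix (Fin n) (Fin n) ℝ :=
  Matrix.of fun i j => ξ s(i, j) ω

theorem edgeMatrix_isSymm {n : ℕ} {Ω : Type*} (ξ : Sym2 (Fin n) → Ω → ℝ) (ω : Ω) : (edgeMatrix ξ ω).IsSymm := by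
  ext i j; simp [edgeMatrix, Sym2.eq_swap]

variable {n : ℕ} {Ω : Type*} [MeasurableSpace Ω] {μ : Measure Ω} {P : Sym2 (Fin n) → ℝ} {ξ : Sym2 (Fin n) → Ω → ℝ}

namespace IsCenteredEdgeFamily

theorem nonneg (h : IsCenteredEdgeFamily μ P ξ) (e : Sym2 (Fin n)) : 0 ≤ P e :=
  (integral_nonneg fun _ => sq_nonneg _).trans (h.integral_sq_le e)

theorem stronglyMeasurable_edgeMatrix (h : IsCenteredEdgeFamily μ P ξ) :
    StronglyMeasurable fun ω => edgeMatrix ξ ω := by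
  have : (fun ω => edgeMatrix ξ ω) =
      fun ω => ∑ i, ∑ j, ξ s(i, j) ω • Matrix.single i j (1 : ℝ) := by
    ext1 ω
    conv_lhs => rw [Matrix.matrix_eq_sum_single (edgeMatrix ξ ω)]
    simp [edgeMatrix, Matrix.smul_single]
  rw [this]
  refine Finset.stronglyMeasurable_fun_sum _ fun i _ =>
    Finset.stronglyMeasurable_fun_sum _ fun j _ => ?_
  exact (h.measurable s(i, j)).stronglyMeasurable.smul_const _

theorem norm_edgeMatrix_le (h : IsCenteredEdgeFamily μ P ξ) (ω : Ω) : ‖edgeMatrix ξ ω‖ ≤ n := by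
  have h1 := sq_norm_le_trace_mul_transpose (edgeMatrix ξ ω)
  have h2 : (edgeMatrix ξ ω * (edgeMatrix ξ ω).transpose).trace ≤ (n : ℝ) ^ 2 := by
    calc _ = ∑ i, ∑ j, edgeMatrix ξ ω i j ^ 2 := by simp [Matrix.trace, Matrix.mul_apply, sq]
      _ ≤ ∑ _i : Fin n, ∑ _j : Fin n, (1 : ℝ) := by
          refine Finset.sum_le_sum fun i _ => Finset.sum_le_sum fun j _ => ?_
          exact (sq_le_one_iff_abs_le_one _).2 (h.abs_le_one _ ω)
      _ = _ := by simp [sq]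
  exact le_of_sq_le_sq (h1.trans h2) (Nat.cast_nonneg n)

variable [IsProbabilityMeasure μ]

theorem integrable_sq (h : IsCenteredEdgeFamily μ P ξ) (e : Sym2 (Fin n)) :
    Integrable (fun ω => ξ e ω ^ 2) μ := by
  refine Integrable.of_bound ((h.measurable e).pow_const 2).aestronglyMeasurable 1
    (Filter.Eventually.of_forall fun ω => ?_)
  rw [norm_pow]
  exact pow_le_one₀ (norm_nonneg _) (h.abs_le_one e ω)

theorem abs_integral_pow_le (h : IsCenteredEdgeFamily μ P ξ) (e : Sym2 (Fin n)) {c : ℕ}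
    (hc : c ≠ 1) : |∫ ω, ξ e ω ^ c ∂μ| ≤ if c ≠ 0 then P e else 1 := by
  by_cases h0 : c = 0
  · simp [h0]
  · rw [if_pos h0]
    rw [← Real.norm_eq_abs]
    refine le_trans ?_ (h.integral_sq_le e)
    refine norm_integral_le_of_norm_le (h.integrable_sq e) (Filter.Eventually.of_forall fun ω => ?_)
    rw [norm_pow, Real.norm_eq_abs, ← sq_abs (ξ e ω)]
    exact pow_le_pow_of_le_one (abs_nonneg _) (h.abs_le_one e ω) (by omega)

-- Independence factorizes the expectation over edges. A factor with exponent 1 vanishes by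
-- centring, and one with exponent at least 2 is at most `P e`, since the variables are bounded by
-- one.
open Classical in
theorem integral_prod_walk_le (h : IsCenteredEdgeFamily μ P ξ) {k : ℕ} (w : Fin (k + 1) → Fin n) :
    ∫ ω, ∏ i, edgeMatrix ξ ω (w i) (w (i + 1)) ∂μ ≤
      newVertexWeight (fun a b => P s(a, b)) w *
        (if NoSimpleEdge (coincidence w) then 1 else 0) := by
  have hprod : ∫ ω, ∏ i, edgeMatrix ξ ω (w i) (w (i + 1)) ∂μ =
      ∏ e, ∫ ω, ξ e ω ^ edgeCount w e ∂μ := by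
    rw [← h.indep.integral_fun_prod_comp (f := fun e x => x ^ edgeCount w e)
      (fun e => (h.measurable e).aemeasurable)
      (fun e => (measurable_id.pow_const _).aestronglyMeasurable)]
    exact integral_congr_ae (Filter.Eventually.of_forall fun ω =>
      prod_edges_eq_prod_pow_edgeCount w fun e => ξ e ω)
  rw [hprod]
  split_ifs with hs
  · rw [noSimpleEdge_coincidence_iff] at hs
    rw [mul_one]
    refine le_trans ?_ (prod_traversed_edges_le_newVertexWeight h.nonneg h.le_one w)
    rw [Finset.prod_filter]
    refine (le_abs_self _).trans ?_
    rw [Finset.abs_prod]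
    exact Finset.prod_le_prod (fun _ _ => abs_nonneg _) fun e _ => h.abs_integral_pow_le e (hs e)
  · rw [noSimpleEdge_coincidence_iff] at hs
    push Not at hs
    obtain ⟨e, he⟩ := hs
    rw [mul_zero, Finset.prod_eq_zero (Finset.mem_univ e)]
    rw [he]
    simpa using h.integral_eq_zero e

theorem integrable_prod_walk (h : IsCenteredEdgeFamily μ P ξ) {k : ℕ} (w : Fin (k + 1) → Fin n) :
    Integrable (fun ω => ∏ i, edgeMatrix ξ ω (w i) (w (i + 1))) μ := by
  refine Integrable.of_bound (Finset.measurable_prod _ fun i _ =>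
    h.measurable s(w i, w (i + 1))).aestronglyMeasurable 1 (Filter.Eventually.of_forall fun ω => ?_)
  rw [norm_prod]
  exact Finset.prod_le_one (fun _ _ => norm_nonneg _) fun i _ => h.abs_le_one _ ω

theorem integrable_trace_pow (h : IsCenteredEdgeFamily μ P ξ) (k : ℕ) :
    Integrable (fun ω => (edgeMatrix ξ ω ^ (k + 1)).trace) μ := by
  simp only [trace_pow_eq_sum_closedWalk]
  exact integrable_finsetSum _ fun w _ => h.integrable_prod_walk w

/-- Trace moments are dominated by those of a matrix of moderate dimension. -/
theorem integral_trace_pow_le (h : IsCenteredEdgeFamily μ P ξ) {k : ℕ}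
    (hD : ∀ a, ∑ b, P s(a, b) ≤ (k + 1 : ℕ)) (hk : Even (k + 1)) :
    ∫ ω, (edgeMatrix ξ ω ^ (k + 1)).trace ∂μ ≤
      n * (5000 * Real.exp 9 * √((k + 1 : ℕ) : ℝ)) ^ (k + 1) := by
  classical
  set q := k + 1 with hq
  set N := Fintype.card (Sym2 (Fin (2 * q)))
  let F : (Fin (k + 1) → Fin (k + 1) → Prop) → ℝ := fun R => if NoSimpleEdge R then 1 else 0
  have hF : ∀ R, 0 ≤ F R := fun R => by simp only [F]; split_ifs <;> norm_num
  have h1 : ∫ ω, (edgeMatrix ξ ω ^ q).trace ∂μ ≤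
      ∑ w : Fin (k + 1) → Fin n, newVertexWeight (fun a b => P s(a, b)) w * F (coincidence w) := by
    simp only [hq, trace_pow_eq_sum_closedWalk]
    rw [integral_finsetSum _ fun w _ => h.integrable_prod_walk w]
    exact Finset.sum_le_sum fun w _ => h.integral_prod_walk_le w
  have h2 := sum_newVertexWeight_le (r := 2 * q) (k := k) (p := fun a b => P s(a, b))
    (fun a b => h.nonneg _) hD (by rw [hq]; push_cast; linarith) F hF
  have h3 : 3 ^ N * ∑ v : Fin (k + 1) → Fin (2 * q), F (coincidence v) ≤
      ∑ ω : Sym2 (Fin (2 * q)) → Fin 3, (threePointMatrix ω ^ q).trace :=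
    card_noSimpleEdge_le_sum_trace (2 * q) k
  have h4 : ∑ ω : Sym2 (Fin (2 * q)) → Fin 3, (threePointMatrix ω ^ q).trace ≤
      (2 * q : ℕ) * (3 ^ N * (5000 * Real.exp 9 * √(q : ℝ)) ^ q) := by
    refine le_trans ?_ (mul_le_mul_of_nonneg_left
      (sum_norm_threePointMatrix_pow_le hk (by omega)) (Nat.cast_nonneg _))
    rw [Finset.mul_sum]
    refine Finset.sum_le_sum fun ω _ => (trace_le_card_mul_norm _).trans ?_
    gcongr
    exact norm_pow_le' _ (by omega)
  have hq0 : (0 : ℝ) < (2 * q : ℕ) := by rw [hq]; positivity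
  have h3N : (0 : ℝ) < 3 ^ N := by positivity
  have h5 : ∑ v : Fin (k + 1) → Fin (2 * q), F (coincidence v) ≤
      (2 * q : ℕ) * (5000 * Real.exp 9 * √(q : ℝ)) ^ q := by
    refine le_of_mul_le_mul_left ((h3.trans h4).trans (le_of_eq ?_)) h3N
    ring
  -- The factor 2q lost in bounding a trace by the norm cancels the factor `r = 2 * q` of the
  -- comparison.
  refine h1.trans (le_of_mul_le_mul_left (h2.trans ?_) hq0)
  calc _ ≤ (n : ℝ) * ((2 * q : ℕ) * (5000 * Real.exp 9 * √(q : ℝ)) ^ q) := by gcongr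
    _ = _ := by ring

theorem integrable_norm_pow (h : IsCenteredEdgeFamily μ P ξ) (q : ℕ) :
    Integrable (fun ω => ‖edgeMatrix ξ ω‖ ^ q) μ := by
  refine Integrable.of_bound (h.stronglyMeasurable_edgeMatrix.norm.pow q).aestronglyMeasurable
    ((n : ℝ) ^ q) (Filter.Eventually.of_forall fun ω => ?_)
  rw [norm_pow, norm_norm]
  exact pow_le_pow_left₀ (norm_nonneg _) (h.norm_edgeMatrix_le ω) q

theorem integrable_norm (h : IsCenteredEdgeFamily μ P ξ) :
    Integrable (fun ω => ‖edgeMatrix ξ ω‖) μ := by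
  simpa using h.integrable_norm_pow 1

/-- The expected norm is at most of the order of the square root of any power of two dominating
the maximal row sum of the variances and the logarithm of the dimension. -/
theorem integral_norm_le (h : IsCenteredEdgeFamily μ P ξ) {l : ℕ}
    (hD : ∀ a, ∑ b, P s(a, b) ≤ (2 : ℝ) ^ (l + 1)) (hn : 0 < n)
    (hlog : Real.log n ≤ (2 : ℝ) ^ (l + 1)) :
    ∫ ω, ‖edgeMatrix ξ ω‖ ∂μ ≤ 10000 * Real.exp 10 * √((2 : ℝ) ^ (l + 1)) := by
  obtain ⟨k, hk⟩ : ∃ k, 2 ^ (l + 1) = k + 1 := ⟨2 ^ (l + 1) - 1, by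
    have := Nat.pos_of_ne_zero (pow_ne_zero (l + 1) (two_ne_zero (α := ℕ))); omega⟩
  have hcast : (2 : ℝ) ^ (l + 1) = ((k + 1 : ℕ) : ℝ) := by rw [← hk]; push_cast; rfl
  rw [hcast] at hD hlog ⊢
  set q := k + 1 with hq
  set b := 5000 * Real.exp 9 * √(q : ℝ) with hb
  have hb0 : 0 < b := by
    have : 0 < √(q : ℝ) := Real.sqrt_pos.2 (by rw [hq]; positivity)
    positivity
  have hmom : ∫ ω, ‖edgeMatrix ξ ω‖ ^ q ∂μ ≤ n * b ^ q := by
    refine le_trans (integral_mono (h.integrable_norm_pow q) (h.integrable_trace_pow k) fun ω => ?_)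
      (h.integral_trace_pow_le hD ?_)
    · have := norm_pow_le_trace_pow (edgeMatrix_isSymm ξ ω) l
      rwa [hk] at this
    · rw [← hq, ← hk, pow_succ]; exact even_two.mul_left _
  obtain ⟨a, ha⟩ : ∃ a, a = Real.exp 1 * b := ⟨_, rfl⟩
  have ha0 : 0 < a := by rw [ha]; positivity
  have hnq : (n : ℝ) ≤ Real.exp 1 ^ q := by
    rw [← Real.exp_nat_mul, mul_one]
    exact (Real.log_le_iff_le_exp (by exact_mod_cast hn)).1 hlog
  -- This pointwise bound replaces Jensen's inequality, at the cost of a factor 2.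
  have hpt : ∀ x : ℝ, 0 ≤ x → x ≤ a + a / a ^ q * x ^ q := by
    intro x hx
    rcases le_total x a with hxa | hxa
    · have : 0 ≤ a / a ^ q * x ^ q := by positivity
      linarith
    · have h1 : x / a ≤ (x / a) ^ q := le_self_pow₀ ((one_le_div ha0).2 hxa) (by omega)
      have h2 : x ≤ a * (x / a) ^ q := by
        calc x = a * (x / a) := by field_simp
          _ ≤ _ := by gcongr
      rw [div_pow] at h2
      have h3 : a * (x ^ q / a ^ q) = a / a ^ q * x ^ q := by ring
      linarith
  calc ∫ ω, ‖edgeMatrix ξ ω‖ ∂μ ≤ ∫ ω, (a + a / a ^ q * ‖edgeMatrix ξ ω‖ ^ q) ∂μ :=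
        integral_mono h.integrable_norm
          ((integrable_const a).add ((h.integrable_norm_pow q).const_mul _))
          fun ω => hpt _ (norm_nonneg _)
    _ = a + a / a ^ q * ∫ ω, ‖edgeMatrix ξ ω‖ ^ q ∂μ := by
        rw [integral_add (integrable_const a) ((h.integrable_norm_pow q).const_mul _),
          integral_const_mul, integral_const, probReal_univ, one_smul]
    _ ≤ a + a / a ^ q * a ^ q := by
        refine add_le_add le_rfl (mul_le_mul_of_nonneg_left (hmom.trans ?_) (by positivity))
        rw [ha, mul_pow (Real.exp 1)]
        exact mul_le_mul_of_nonneg_right hnq (pow_pos hb0 q).le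
    _ = 2 * a := by field_simp; ring
    _ = _ := by
        have : Real.exp 10 = Real.exp 1 * Real.exp 9 := by rw [← Real.exp_add]; norm_num
        rw [ha, hb, this]; ring

end IsCenteredEdgeFamily

end RandomMatrix
-- Application to the random graph.
namespace IsInhomogeneousRandomGraph

variable {n : ℕ} {Ω : Type*} [MeasurableSpace Ω] {μ : Measure Ω}
  {p : Matrix (Fin n) (Fin n) ℝ} {A : Ω → Matrix (Fin n) (Fin n) ℝ}

theorem prob_symm (h : IsInhomogeneousRandomGraph μ p A) (i j : Fin n) : p i j = p j i := by
  rw [← h.prob i j, ← h.prob j i]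
  congr 1
  ext ω
  rw [Set.mem_ofPred_eq, Set.mem_ofPred_eq, (h.symm ω).apply i j]

theorem prob_nonneg (h : IsInhomogeneousRandomGraph μ p A) (i j : Fin n) : 0 ≤ p i j := by
  rw [← h.prob i j]; exact measureReal_nonneg

theorem integral_entry (h : IsInhomogeneousRandomGraph μ p A) (i j : Fin n) :
    ∫ ω, A ω i j ∂μ = p i j := by
  have hind : (fun ω => A ω i j) = Set.indicator {ω | A ω i j = 1} 1 := by
    ext ω
    rcases h.zero_or_one ω i j with h | h <;> simp [Set.indicator, h]
  have hm : MeasurableSet {ω | A ω i j = 1} := h.measurable i j (measurableSet_singleton 1)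
  rw [hind, integral_indicator_one hm, h.prob]

variable [IsProbabilityMeasure μ]

theorem prob_le_one (h : IsInhomogeneousRandomGraph μ p A) (i j : Fin n) : p i j ≤ 1 := by
  rw [← h.prob i j]; exact measureReal_le_one

theorem integrable_entry (h : IsInhomogeneousRandomGraph μ p A) (i j : Fin n) :
    Integrable (fun ω => A ω i j) μ := by
  refine Integrable.of_bound (h.measurable i j).aestronglyMeasurable 1
    (Filter.Eventually.of_forall fun ω => ?_)
  rcases h.zero_or_one ω i j with h | h <;> simp [h]

theorem integral_abs_centered_le (h : IsInhomogeneousRandomGraph μ p A) (i j : Fin n) :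
    ∫ ω, |A ω i j - p i j| ∂μ ≤ 2 * p i j := by
  calc ∫ ω, |A ω i j - p i j| ∂μ ≤ ∫ ω, (A ω i j + p i j) ∂μ := by
        refine integral_mono ((h.integrable_entry i j).sub (integrable_const _)).abs
          ((h.integrable_entry i j).add (integrable_const _)) fun ω => ?_
        have := h.prob_nonneg i j
        have := h.prob_le_one i j
        rcases h.zero_or_one ω i j with h | h <;> simp only [h] <;> rw [abs_le] <;>
          constructor <;> linarith
    _ = 2 * p i j := by
        rw [integral_add (h.integrable_entry i j) (integrable_const _), h.integral_entry,
          integral_const, probReal_univ, one_smul]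
        ring

/-- The centred entries on and above the diagonal, indexed by unordered pairs. -/
def centeredEdge (p : Matrix (Fin n) (Fin n) ℝ) (A : Ω → Matrix (Fin n) (Fin n) ℝ)
    (e : Sym2 (Fin n)) (ω : Ω) : ℝ :=
  A ω (Sym2.sortEquiv e).1.1 (Sym2.sortEquiv e).1.2 -
    p (Sym2.sortEquiv e).1.1 (Sym2.sortEquiv e).1.2

/-- The value of a symmetric matrix at the sorted representative of an unordered pair. -/
theorem apply_sortEquiv {M : Matrix (Fin n) (Fin n) ℝ} (hM : ∀ i j, M i j = M j i) (i j : Fin n) :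
    M (Sym2.sortEquiv s(i, j)).1.1 (Sym2.sortEquiv s(i, j)).1.2 = M i j := by
  rcases le_total i j with hij | hij
  · simp [Sym2.sortEquiv, hij]
  · simp [Sym2.sortEquiv, hij, hM i j]

theorem isCenteredEdgeFamily (h : IsInhomogeneousRandomGraph μ p A) :
    IsCenteredEdgeFamily μ
      (fun e => p (Sym2.sortEquiv e).1.1 (Sym2.sortEquiv e).1.2) (centeredEdge p A) where
  measurable e := (h.measurable _ _).sub_const _
  abs_le_one e ω := by
    have h0 := h.prob_nonneg (Sym2.sortEquiv e).1.1 (Sym2.sortEquiv e).1.2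
    have h1 := h.prob_le_one (Sym2.sortEquiv e).1.1 (Sym2.sortEquiv e).1.2
    rw [centeredEdge, abs_le]
    rcases h.zero_or_one ω (Sym2.sortEquiv e).1.1 (Sym2.sortEquiv e).1.2 with h | h <;>
      rw [h] <;> constructor <;> linarith
  indep := (h.indep.precomp Sym2.sortEquiv.injective).comp
    (fun e x => x - p (Sym2.sortEquiv e).1.1 (Sym2.sortEquiv e).1.2)
    fun e => measurable_id.sub_const _
  integral_eq_zero e := by
    simp only [centeredEdge]
    rw [integral_sub (h.integrable_entry _ _) (integrable_const _), h.integral_entry,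
      integral_const, probReal_univ, one_smul, sub_self]
  integral_sq_le e := by
    simp only [centeredEdge]
    generalize (Sym2.sortEquiv e).1.1 = i
    generalize (Sym2.sortEquiv e).1.2 = j
    have hsq : ∀ ω, (A ω i j - p i j) ^ 2 = (1 - 2 * p i j) * A ω i j + p i j ^ 2 := fun ω => by
      rcases h.zero_or_one ω i j with h | h <;> rw [h] <;> ring
    simp only [hsq]
    rw [integral_add ((h.integrable_entry i j).const_mul _) (integrable_const _),
      integral_const_mul, h.integral_entry, integral_const, probReal_univ, one_smul]
    nlinarith [sq_nonneg (p i j)]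
  le_one e := h.prob_le_one _ _

theorem sub_expectedMatrix_eq (h : IsInhomogeneousRandomGraph μ p A) (ω : Ω) :
    A ω - expectedMatrix μ A = edgeMatrix (centeredEdge p A) ω := by
  ext i j
  rw [edgeMatrix, Matrix.of_apply, centeredEdge,
    apply_sortEquiv (fun i j => ((h.symm ω).apply j i)), apply_sortEquiv h.prob_symm,
    Matrix.sub_apply, expectedMatrix, Matrix.of_apply, h.integral_entry]

theorem sum_prob_le_maxExpectedDegree (p : Matrix (Fin n) (Fin n) ℝ) (i : Fin n) :
    ∑ j, p i j ≤ maxExpectedDegree p :=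
  le_ciSup (f := fun i => ∑ j, p i j) (Set.finite_range _).bddAbove i

/-- Here log n = 0 and d may be arbitrarily small, so a moment order of at least 2 is too wasteful;
instead, p ≤ √p on [0, 1]. -/
theorem integral_norm_le_of_fin_one {p : Matrix (Fin 1) (Fin 1) ℝ}
    {A : Ω → Matrix (Fin 1) (Fin 1) ℝ} (h : IsInhomogeneousRandomGraph μ p A) :
    ∫ ω, ‖A ω - expectedMatrix μ A‖ ∂μ ≤ 2 * √(maxExpectedDegree p) := by
  have hp0 := h.prob_nonneg 0 0
  have hp1 := h.prob_le_one 0 0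
  have hd : maxExpectedDegree p = p 0 0 := by simp [maxExpectedDegree]
  have hpt : ∀ ω, ‖A ω - expectedMatrix μ A‖ ≤ |A ω 0 0 - p 0 0| := fun ω => by
    have h1 := sq_norm_le_trace_mul_transpose (A ω - expectedMatrix μ A)
    have he : expectedMatrix μ A 0 0 = p 0 0 := h.integral_entry 0 0
    simp only [Matrix.trace, Matrix.diag, Matrix.mul_apply, Matrix.transpose_apply,
      Fin.sum_univ_one, Matrix.sub_apply, he] at h1
    refine abs_le_of_sq_le_sq' ?_ (abs_nonneg _) |>.2
    rw [sq_abs]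
    simpa [sq] using h1
  have hint : Integrable (fun ω => ‖A ω - expectedMatrix μ A‖) μ := by
    simpa only [h.sub_expectedMatrix_eq] using h.isCenteredEdgeFamily.integrable_norm
  calc _ ≤ ∫ ω, |A ω 0 0 - p 0 0| ∂μ :=
        integral_mono hint ((h.integrable_entry 0 0).sub (integrable_const _)).abs hpt
    _ ≤ 2 * p 0 0 := h.integral_abs_centered_le 0 0
    _ ≤ 2 * √(maxExpectedDegree p) := by
        rw [hd]
        gcongr
        exact Real.le_sqrt_of_sq_le (by nlinarith)

theorem integral_norm_le_of_two_le (h : IsInhomogeneousRandomGraph μ p A) (hn : 2 ≤ n) :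
    ∫ ω, ‖A ω - expectedMatrix μ A‖ ∂μ ≤
      20000 * Real.exp 10 * (√(maxExpectedDegree p) + √(Real.log n)) := by
  have hlog : 1 / 2 ≤ Real.log n := by
    have h1 : Real.log 2 ≤ Real.log n := Real.log_le_log (by norm_num) (by exact_mod_cast hn)
    linarith [Real.log_two_gt_d9]
  have hd0 : 0 ≤ maxExpectedDegree p :=
    (Finset.sum_nonneg fun j _ => h.prob_nonneg ⟨0, by omega⟩ j).trans
      (sum_prob_le_maxExpectedDegree p ⟨0, by omega⟩)
  -- The moment order is the first power of two above d + 2 log n. The coefficient 2 ensures that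
  -- this quantity is at least 1 for all n ≥ 2.
  obtain ⟨l, hl1, hl2⟩ := exists_nat_pow_near
    (show 1 ≤ maxExpectedDegree p + 2 * Real.log n by linarith) (one_lt_two (α := ℝ))
  have hmain := h.isCenteredEdgeFamily.integral_norm_le (l := l)
    (fun a => by
      simp only [apply_sortEquiv h.prob_symm]
      linarith [sum_prob_le_maxExpectedDegree p a]) (by omega) (by linarith)
  simp only [h.sub_expectedMatrix_eq]
  refine hmain.trans ?_
  have hsqrt : √((2 : ℝ) ^ (l + 1)) ≤ 2 * (√(maxExpectedDegree p) + √(Real.log n)) := by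
    refine Real.sqrt_le_iff.2 ⟨by positivity, ?_⟩
    have e1 := Real.sq_sqrt hd0
    have e2 := Real.sq_sqrt (show 0 ≤ Real.log n by linarith)
    have e3 := mul_nonneg (Real.sqrt_nonneg (maxExpectedDegree p)) (Real.sqrt_nonneg (Real.log n))
    rw [pow_succ]
    nlinarith
  calc _ ≤ 10000 * Real.exp 10 * (2 * (√(maxExpectedDegree p) + √(Real.log n))) := by gcongr
    _ = _ := by ring

theorem integral_norm_le (h : IsInhomogeneousRandomGraph μ p A) :
    ∫ ω, ‖A ω - expectedMatrix μ A‖ ∂μ ≤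
      20000 * Real.exp 10 * (√(maxExpectedDegree p) + √(Real.log n)) := by
  match n, p, A, h with
  | 0, p, A, h =>
    have : ∀ ω, ‖A ω - expectedMatrix μ A‖ = 0 := fun ω => by
      rw [Subsingleton.elim (A ω - expectedMatrix μ A) 0, norm_zero]
    simp only [this, integral_zero]
    positivity
  | 1, p, A, h =>
    refine h.integral_norm_le_of_fin_one.trans ?_
    have h10 : 1 ≤ Real.exp 10 := Real.one_le_exp (by norm_num)
    gcongr
    · linarith
    · linarith [Real.sqrt_nonneg (Real.log (1 : ℕ))]
  | n + 2, p, A, h => exact h.integral_norm_le_of_two_le (by omega)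

end IsInhomogeneousRandomGraph

-- `‖·‖` on matrices is the operator norm with respect to the Euclidean norm.
theorem mainTheorem5 :
    (∃ C : ℝ, 0 < C ∧
      ∀ (n : ℕ) (Ω : Type u) [MeasurableSpace Ω] (μ : Measure Ω) [IsProbabilityMeasure μ]
        (p : Matrix (Fin n) (Fin n) ℝ) (A : Ω → Matrix (Fin n) (Fin n) ℝ),
        IsInhomogeneousRandomGraph μ p A →
          Integrable (fun ω => ‖A ω - expectedMatrix μ A‖) μ ∧
          ∫ ω, ‖A ω - expectedMatrix μ A‖ ∂μ ≤
            C * (√(maxExpectedDegree p) + √(Real.log n))) ∧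
    (∀ c : ℝ, 0 < c → ∃ C : ℝ, 0 < C ∧
      ∀ (n : ℕ) (Ω : Type u) [MeasurableSpace Ω] (μ : Measure Ω) [IsProbabilityMeasure μ]
        (p : Matrix (Fin n) (Fin n) ℝ) (A : Ω → Matrix (Fin n) (Fin n) ℝ),
        IsInhomogeneousRandomGraph μ p A → c * Real.log n ≤ maxExpectedDegree p →
          ∫ ω, ‖A ω - expectedMatrix μ A‖ ∂μ ≤ C * √(maxExpectedDegree p)) := by
  refine ⟨⟨20000 * Real.exp 10, by positivity, fun n Ω _ μ _ p A h => ⟨?_, h.integral_norm_le⟩⟩,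
    fun c hc => ⟨20000 * Real.exp 10 * (1 + √(1 / c)), by positivity,
      fun n Ω _ μ _ p A h hd => h.integral_norm_le.trans ?_⟩⟩
  · simpa only [h.sub_expectedMatrix_eq] using h.isCenteredEdgeFamily.integrable_norm
  · have hlog : √(Real.log n) ≤ √(1 / c) * √(maxExpectedDegree p) := by
      rw [← Real.sqrt_mul (by positivity)]
      refine Real.sqrt_le_sqrt ?_
      rw [one_div, inv_mul_eq_div, le_div_iff₀ hc]
      linarith
    calc _ ≤ 20000 * Real.exp 10 *
          (√(maxExpectedDegree p) + √(1 / c) * √(maxExpectedDegree p)) := by gcongr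
      _ = _ := by ring
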